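/- **Proposition (GIoU's distribution).** For planar sets $A,B$ of positive area let $$\mathrm{GIoU}(A,B)=\frac{|A\cap B|}{|A\cup B|}-\frac{|C\setminus(A\cup B)|}{|C|},$$ where $|\cdot|$ is area and $C$ is the convex hull of $A\cup B$. Let $\omega,\sigma>0$ and $a=\sigma/\omega$, let $X\sim\mathcal N(0,\sigma^2)$, let $b_1$ and $b_2$ be the axis-parallel squares of side $\omega$ centered at $(0,y)$ and $(X,y)$, and let $Z=\mathrm{GIoU}(b_1,b_2)$. Then $Z=\dfrac{\omega-|X|}{\omega+|X|}$, and $Z$ has the probability density function $$d_Z(z)=\frac{4\omega}{(1+z)^2\sqrt{2\pi}\,\sigma}\exp\left(-\frac12\left[\frac{\omega(1-z)}{\sigma(1+z)}\right]^2\right)\quad\text{for }-1<z\le 1,$$ and $d_Z(z)=0$ for all other real $z$. The first two moments of $Z$ exist and are given by $$\mathbb E[Z]=\frac{2}{\pi^{3/2}}\,G^{2,3}_{3,2}\left(2a^2\,\bigg|\,\begin{matrix}0&\frac12&\frac12\\ \frac12&0\end{matrix}\right)-1,$$ $$\mathbb E[Z^2]=1-\frac{8a}{\sqrt{2\pi}}+\frac{16a^2}{\pi^{3/2}}\,G^{2,3}_{3,2}\left(2a^2\,\bigg|\,\begin{matrix}-1&\frac12&-\frac12\\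 \frac12&0\end{matrix}\right).$$ Here $G$ is the Meijer G-function $$G^{m,n}_{p,q}\left(z\,\bigg|\,\begin{matrix}a_1&\dots&a_p\\ b_1&\dots&b_q\end{matrix}\right)=\frac1{2\pi i}\int_L\frac{\prod_{j=1}^m\Gamma(b_j-s)\prod_{j=1}^n\Gamma(1-a_j+s)}{\prod_{j=m+1}^q\Gamma(1-b_j+s)\prod_{j=n+1}^p\Gamma(a_j-s)}\,z^s\,ds,$$ where $L$ runs from $-i\infty$ to $+i\infty$ and has the poles of $\Gamma(b_j-s)$, $j\le m$, on its right and those of $\Gamma(1-a_j+s)$, $j\le n$, on its left. For the two functions above, $L$ can be any vertical line $\operatorname{Re}s=c$ with $-\frac12<c<0$; the integral converges absolutely and does not depend on $c$. -/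

import Mathlib

open MeasureTheory ProbabilityTheory

noncomputable section

/-- The axis-parallel box in the plane with center `(x, y)`, width `w` and height `h`. -/
def box (x y w h : ℝ) : Set (ℝ × ℝ) :=
  Set.Icc (x - w / 2) (x + w / 2) ×ˢ Set.Icc (y - h / 2) (y + h / 2)

/-- The area (planar Lebesgue measure) of a set. -/
def area (A : Set (ℝ × ℝ)) : ℝ :=
  (volume : Measure (ℝ × ℝ)).real A

/-- Intersection over union of two planar sets. -/
def iou (A B : Set (ℝ × ℝ)) : ℝ :=
  area (A ∩ B) / area (A ∪ B)

/-- Generalized intersection over union: `IoU(A, B) - |C \ (A ∪ B)| / |C|`, where `C` is the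
convex hull of `A ∪ B`. -/
def giou (A B : Set (ℝ × ℝ)) : ℝ :=
  iou A B - area (convexHull ℝ (A ∪ B) \ (A ∪ B)) / area (convexHull ℝ (A ∪ B))

/-- The probability density
`z ↦ 4ω / ((1 + z)² √(2π) σ) · exp (-(1/2) (ω (1 - z) / (σ (1 + z)))²)` on `(-1, 1]`,
extended by zero. -/
def giouDensity (ω σ z : ℝ) : ℝ :=
  (Set.Ioc (-1 : ℝ) 1).indicator
    (fun z => 4 * ω / ((1 + z) ^ 2 * √(2 * Real.pi) * σ) *
      Real.exp (-(1 / 2) * (ω * (1 - z) / (σ * (1 + z))) ^ 2)) z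

/-- The integrand, as a function of `s`, of the Mellin-Barnes integral that defines the Meijer
function `G^{m,n}_{p,q}(z | a₁ … a_p; b₁ … b_q)`. The indices are shifted: `a j` is the parameter
with number `j + 1`. At a pole of `Γ` Mathlib has `Γ⁻¹ = 0`, so the factors `Γ⁻¹` below are the
entire function `1 / Γ`. -/
def meijerIntegrand (m n : ℕ) {p q : ℕ} (a : Fin p → ℂ) (b : Fin q → ℂ) (z s : ℂ) : ℂ :=
  (∏ j : Fin q, if (j : ℕ) < m then Complex.Gamma (b j - s) else (Complex.Gamma (1 - b j + s))⁻¹) *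
  (∏ j : Fin p, if (j : ℕ) < n then Complex.Gamma (1 - a j + s) else (Complex.Gamma (a j - s))⁻¹) *
  z ^ s

/-- The vertical line `Re s = c` separates the two families of poles of the integrand: it has all
poles of `Γ(b_j - s)`, `j ≤ m`, to its right and all poles of `Γ(1 - a_j + s)`, `j ≤ n`, to its
left. -/
def MeijerSeparates (m n : ℕ) {p q : ℕ} (a : Fin p → ℂ) (b : Fin q → ℂ) (c : ℝ) : Prop :=
  (∀ j : Fin q, (j : ℕ) < m → c < (b j).re) ∧
  (∀ j : Fin p, (j : ℕ) < n → (a j).re - 1 < c)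

/-- `G` is the value at `z ≠ 0` of the Meijer function `G^{m,n}_{p,q}(· | a; b)`: its contour
`L` can be taken to be a vertical line from `c - i∞` to `c + i∞` that separates the poles, and for
every such line the integral `(2πi)⁻¹ ∫_L` of the integrand converges absolutely and equals `G`. -/
def HasMeijerG (m n : ℕ) {p q : ℕ} (a : Fin p → ℂ) (b : Fin q → ℂ) (z G : ℂ) : Prop :=
  z ≠ 0 ∧ (∃ c : ℝ, MeijerSeparates m n a b c) ∧
  ∀ c : ℝ, MeijerSeparates m n a b c →
    Integrable (fun t : ℝ => meijerIntegrand m n a b z (c + t * Complex.I)) ∧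
    (2 * Real.pi * Complex.I)⁻¹ *
      ∫ t : ℝ, meijerIntegrand m n a b z (c + t * Complex.I) * Complex.I = G

open Classical in
/-- The Meijer function `G^{m,n}_{p,q}(z | a; b)`, for parameters whose contour can be taken to be
a vertical line on which the integral converges absolutely (and `0` otherwise). -/
def meijerG (m n : ℕ) {p q : ℕ} (a : Fin p → ℂ) (b : Fin q → ℂ) (z : ℂ) : ℂ :=
  if h : ∃ G : ℂ, HasMeijerG m n a b z G then h.choose else 0

theorem HasMeijerG.meijerG_eq {m n p q : ℕ} {a : Fin p → ℂ} {b : Fin q → ℂ} {z G : ℂ}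
    (h : HasMeijerG m n a b z G) : meijerG m n a b z = G := by
  have hex : ∃ G : ℂ, HasMeijerG m n a b z G := ⟨G, h⟩
  obtain ⟨c, hc⟩ := h.2.1
  rw [meijerG, dif_pos hex, ← (hex.choose_spec.2.2 c hc).2, (h.2.2 c hc).2]

end

/-!
Both squares have the same vertical side, so the GIoU reduces to lengths of intervals: the hull has
length `ω + |X|`, and the intersection has length `max (ω - |X|) 0`. Overlapping or not,
`Z = (ω - |X|) / (ω + |X|)` (`giou_box_box`). The density then comes from folding the Gaussian onto
the half-line and substituting `x = ω (1 - z) / (1 + z)` (`hasLaw_giou_gaussianReal`).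

For the moments put `V = |X| / ω`, `z = 2 a²` and
`M k = ∫ v in (0, ∞), e^{-v²/z} (1 + v)^{-k}`.
Since `Z = 2 / (1 + V) - 1`, the mean of `Z` is an affine function of `M 1`; since
`Z² = 1 - 4 V / (1 + V)²`, an integration by parts makes the mean of `Z²` an affine function of
`M 3` (`integral_exp_neg_sq_div_mul_div_one_add_sq`).

The Meijer functions are multiples of `M 1` and `M 3`. The Beta integral gives the Mellin transform
`Γ(s) Γ(k - s) / Γ(k)` of `(1 + v)^{-k}` (`hasMellin_inv_one_add_pow`). Inserting its Mellin
inversion formula into `M k` and exchanging integrals leaves the Mellin transform of a Gaussian, so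
that `M k` is a line integral of `Γ(s) Γ(k - s) Γ((1 - s) / 2) z^{-s/2}`
(`integral_Gamma_mul_Gamma_mul_Gamma`). The decay on vertical lines that inversion and Fubini need
comes from the reflection formula. Legendre duplication, applied to the two pairs of Gamma factors
whose arguments differ by `1 / 2`, turns the Meijer integrands into this one at `-2 s`
(`hasMeijerG_of_integrand_eq`).
-/

/-! ### The closed form of the GIoU of two shifted squares -/

lemma convexHull_Icc_union_Icc {p q r s : ℝ} (hpq : p ≤ q) (hrs : r ≤ s) :
    convexHull ℝ (Set.Icc p q ∪ Set.Icc r s) = Set.Icc (min p r) (max q s) := by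
  apply Set.Subset.antisymm
  · refine convexHull_min ?_ (convex_Icc _ _)
    exact Set.union_subset (Set.Icc_subset_Icc (min_le_left _ _) (le_max_left _ _))
      (Set.Icc_subset_Icc (min_le_right _ _) (le_max_right _ _))
  · have hmin : min p r ∈ Set.Icc p q ∪ Set.Icc r s := by
      rcases min_choice p r with h | h <;> rw [h]
      · exact Or.inl (Set.left_mem_Icc.2 hpq)
      · exact Or.inr (Set.left_mem_Icc.2 hrs)
    have hmax : max q s ∈ Set.Icc p q ∪ Set.Icc r s := by
      rcases max_choice q s with h | h <;> rw [h]
      · exact Or.inl (Set.right_mem_Icc.2 hpq)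
      · exact Or.inr (Set.right_mem_Icc.2 hrs)
    rw [← segment_eq_Icc ((min_le_left _ _).trans (hpq.trans (le_max_left _ _)))]
    exact (convex_convexHull ℝ _).segment_subset (subset_convexHull ℝ _ hmin)
      (subset_convexHull ℝ _ hmax)

lemma area_prod (s t : Set ℝ) : area (s ×ˢ t) = volume.real s * volume.real t := by
  rw [area, Measure.volume_eq_prod, measureReal_prod_prod]

/-- The formula holds also when the squares are disjoint: the intersection is then empty and the gap
in the hull contributes the negative value. -/
theorem giou_box_box {ω : ℝ} (hω : 0 < ω) (x y : ℝ) :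
    giou (box 0 y ω ω) (box x y ω ω) = (ω - |x|) / (ω + |x|) := by
  set I : Set ℝ := Set.Icc (0 - ω / 2) (0 + ω / 2) with hI
  set K : Set ℝ := Set.Icc (x - ω / 2) (x + ω / 2) with hK
  set J : Set ℝ := Set.Icc (y - ω / 2) (y + ω / 2) with hJ
  have hJv : volume.real J = ω := by
    rw [hJ, Real.volume_real_Icc_of_le (by linarith)]; ring
  have hIv : volume.real I = ω := by
    rw [hI, Real.volume_real_Icc_of_le (by linarith)]; ring
  have hKv : volume.real K = ω := by
    rw [hK, Real.volume_real_Icc_of_le (by linarith)]; ring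
  have hcap : volume.real (I ∩ K) = max (ω - |x|) 0 := by
    rw [hI, hK, Set.Icc_inter_Icc, Real.volume_real_Icc]
    congr 1
    rcases le_total 0 x with h | h
    · rw [abs_of_nonneg h, inf_of_le_left (by linarith), sup_of_le_right (by linarith)]; ring
    · rw [abs_of_nonpos h, inf_of_le_right (by linarith), sup_of_le_left (by linarith)]; ring
  have hcup : volume.real (I ∪ K) = 2 * ω - max (ω - |x|) 0 := by
    have h := measureReal_union_add_inter (μ := volume) (s := I) (t := K) measurableSet_Icc
      (by simp [hI]) (by simp [hK])
    linarith
  have hhull : convexHull ℝ (I ∪ K) = Set.Icc (min (0 - ω / 2) (x - ω / 2))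
      (max (0 + ω / 2) (x + ω / 2)) :=
    convexHull_Icc_union_Icc (by linarith) (by linarith)
  have hhullv : volume.real (convexHull ℝ (I ∪ K)) = ω + |x| := by
    rw [hhull]
    rcases le_total 0 x with h | h
    · rw [abs_of_nonneg h, min_eq_left (by linarith), max_eq_right (by linarith),
        Real.volume_real_Icc_of_le (by linarith)]; ring
    · rw [abs_of_nonpos h, min_eq_right (by linarith), max_eq_left (by linarith),
        Real.volume_real_Icc_of_le (by linarith)]; ring
  have hdiff : volume.real (convexHull ℝ (I ∪ K) \ (I ∪ K)) =
      ω + |x| - (2 * ω - max (ω - |x|) 0) := by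
    rw [measureReal_sdiff (subset_convexHull ℝ _) (measurableSet_Icc.union measurableSet_Icc)
      (by rw [hhull]; exact measure_Icc_lt_top.ne), hhullv, hcup]
  have hbox : giou (box 0 y ω ω) (box x y ω ω) = iou (I ×ˢ J) (K ×ˢ J) -
      area (convexHull ℝ (I ×ˢ J ∪ K ×ˢ J) \ (I ×ˢ J ∪ K ×ˢ J)) /
        area (convexHull ℝ (I ×ˢ J ∪ K ×ˢ J)) := rfl
  have hdiffprod : convexHull ℝ (I ∪ K) ×ˢ J \ (I ∪ K) ×ˢ J =
      (convexHull ℝ (I ∪ K) \ (I ∪ K)) ×ˢ J := by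
    ext ⟨u, v⟩; simp only [Set.mem_sdiff, Set.mem_prod]; tauto
  rw [hbox, iou, ← Set.union_prod, ← Set.inter_prod, convexHull_prod,
    (convex_Icc _ _).convexHull_eq, hdiffprod, area_prod, area_prod, area_prod, area_prod,
    hdiff, hhullv, hcap, hcup, hJv, mul_div_mul_right _ _ hω.ne', mul_div_mul_right _ _ hω.ne']
  have hx := abs_nonneg x
  rcases le_total (ω - |x|) 0 with h | h
  · rw [max_eq_right h, zero_div, zero_sub, ← neg_div]; ring
  · rw [max_eq_left h, show ω + |x| - (2 * ω - (ω - |x|)) = 0 by ring, zero_div, sub_zero]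
    congr 1; ring

/-! ### The density of the GIoU -/

/-- A nonnegative even function has twice its integral over the positive half-line. -/
lemma lintegral_comp_abs (f : ℝ → ENNReal) :
    ∫⁻ x, f |x| = 2 * ∫⁻ x in Set.Ioi 0, f x := by
  have hneg : ∫⁻ x in Set.Iio 0, f |x| = ∫⁻ x in Set.Ioi 0, f |x| := by
    have h := (Measure.measurePreserving_neg (volume : Measure ℝ)).setLIntegral_comp_preimage_emb
      (MeasurableEquiv.neg ℝ).measurableEmbedding (fun x => f |x|) (Set.Ioi 0)
    simpa using h
  have hpos : ∫⁻ x in Set.Ioi 0, f |x| = ∫⁻ x in Set.Ioi 0, f x :=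
    setLIntegral_congr_fun measurableSet_Ioi fun x hx => by rw [abs_of_pos hx]
  rw [← lintegral_add_compl _ (measurableSet_Iio (a := (0 : ℝ))), Set.compl_Iio,
    setLIntegral_congr Ioi_ae_eq_Ici.symm, hneg, hpos, two_mul]

/-- The substitution `x = ω (1 - z) / (1 + z)` takes twice the Gaussian density on the positive
half-line to the density of the GIoU. -/
lemma setLIntegral_gaussianPDFReal_eq {ω σ : ℝ} (hω : 0 < ω) (hσ : 0 < σ) {A : Set ℝ} :
    2 * ∫⁻ x in Set.Ioi 0, A.indicator 1 ((ω - x) / (ω + x)) *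
        ENNReal.ofReal (gaussianPDFReal 0 (Real.toNNReal (σ ^ 2)) x) =
      ∫⁻ z, A.indicator 1 z * ENNReal.ofReal (giouDensity ω σ z) := by
  set h : ℝ → ℝ := fun z => ω * (1 - z) / (1 + z) with hh
  have himage : h '' Set.Ioo (-1) 1 = Set.Ioi 0 := by
    ext x
    simp only [Set.mem_image, Set.mem_Ioo, Set.mem_Ioi, hh]
    constructor
    · rintro ⟨z, ⟨h1, h2⟩, rfl⟩
      exact div_pos (mul_pos hω (by linarith)) (by linarith)
    · intro hx
      refine ⟨(ω - x) / (ω + x), ⟨?_, ?_⟩, ?_⟩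
      · rw [lt_div_iff₀ (by linarith)]; linarith
      · rw [div_lt_iff₀ (by linarith)]; linarith
      · have hx' : ω + x ≠ 0 := by linarith
        rw [show 1 + (ω - x) / (ω + x) = 2 * ω / (ω + x) by field_simp; ring,
          show 1 - (ω - x) / (ω + x) = 2 * x / (ω + x) by field_simp; ring]
        field_simp
  have hderiv : ∀ z ∈ Set.Ioo (-1 : ℝ) 1,
      HasDerivWithinAt h (-(2 * ω) / (1 + z) ^ 2) (Set.Ioo (-1) 1) z := by
    intro z hz
    have hz' : 1 + z ≠ 0 := by linarith [hz.1]
    have h1 := (((hasDerivAt_id z).const_sub 1).const_mul ω).div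
      ((hasDerivAt_id z).const_add 1) hz'
    refine (h1.congr_deriv ?_).hasDerivWithinAt
    simp only [id]
    ring
  have hinj : Set.InjOn h (Set.Ioo (-1) 1) := by
    intro z hz w hw hzw
    have hz' : 1 + z ≠ 0 := by linarith [hz.1]
    have hw' : 1 + w ≠ 0 := by linarith [hw.1]
    simp only [hh] at hzw
    rw [div_eq_div_iff hz' hw'] at hzw
    have : ω * (w - z) = 0 := by linarith
    rcases mul_eq_zero.1 this with h | h <;> linarith
  rw [← himage, lintegral_image_eq_lintegral_abs_deriv_mul measurableSet_Ioo hderiv hinj,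
    ← lintegral_const_mul' _ _ (by simp)]
  have hind : ∀ z, A.indicator 1 z * ENNReal.ofReal (giouDensity ω σ z) =
      (Set.Ioc (-1 : ℝ) 1).indicator
        (fun z => A.indicator 1 z * ENNReal.ofReal (giouDensity ω σ z)) z := by
    intro z
    by_cases hz : z ∈ Set.Ioc (-1 : ℝ) 1
    · rw [Set.indicator_of_mem hz]
    · rw [Set.indicator_of_notMem hz, giouDensity, Set.indicator_of_notMem hz]; simp
  -- The support `(-1, 1]` of the density exceeds the range `(-1, 1)` by a null set.
  rw [lintegral_congr hind, lintegral_indicator measurableSet_Ioc,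
    ← setLIntegral_congr Ioo_ae_eq_Ioc]
  refine setLIntegral_congr_fun measurableSet_Ioo fun z hz => ?_
  have hz' : 0 < 1 + z := by linarith [hz.1]
  have hinv : (ω - h z) / (ω + h z) = z := by
    have : ω + h z ≠ 0 := by
      have : h z ∈ Set.Ioi 0 := by rw [← himage]; exact Set.mem_image_of_mem h hz
      rw [Set.mem_Ioi] at this
      linarith
    rw [div_eq_iff this, hh]
    field_simp; ring
  have hdens : giouDensity ω σ z = 2 * (|-(2 * ω) / (1 + z) ^ 2| *
      gaussianPDFReal 0 (Real.toNNReal (σ ^ 2)) (h z)) := by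
    rw [giouDensity, Set.indicator_of_mem (Set.Ioo_subset_Ioc_self hz), gaussianPDFReal,
      Real.coe_toNNReal _ (sq_nonneg σ), neg_div, abs_neg, abs_of_pos (by positivity),
      Real.sqrt_mul (by positivity) (σ ^ 2), Real.sqrt_sq hσ.le, hh]
    rw [show -(ω * (1 - z) / (1 + z) - 0) ^ 2 / (2 * σ ^ 2) =
      -(1 / 2) * (ω * (1 - z) / (σ * (1 + z))) ^ 2 by field_simp; ring]
    field_simp; ring
  rw [hinv, hdens, ENNReal.ofReal_mul (by norm_num), ENNReal.ofReal_mul (abs_nonneg _)]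
  rw [ENNReal.ofReal_ofNat]
  ring

theorem hasLaw_giou_gaussianReal {ω σ : ℝ} (hω : 0 < ω) (hσ : 0 < σ) :
    HasLaw (fun x : ℝ => (ω - |x|) / (ω + |x|))
      (volume.withDensity fun z => ENNReal.ofReal (giouDensity ω σ z))
      (gaussianReal 0 (Real.toNNReal (σ ^ 2))) := by
  have hmeas : Measurable fun x : ℝ => (ω - |x|) / (ω + |x|) := by fun_prop
  -- A zero variance would make `gaussianReal` a Dirac mass, without a density.
  have hv : Real.toNNReal (σ ^ 2) ≠ 0 := by simpa using hσ.ne'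
  refine ⟨hmeas.aemeasurable, ?_⟩
  ext A hA
  have heven : ∀ x, (A.indicator 1 ((ω - |x|) / (ω + |x|)) : ENNReal) *
      gaussianPDF 0 (Real.toNNReal (σ ^ 2)) x =
      A.indicator 1 ((ω - |x|) / (ω + |x|)) *
        ENNReal.ofReal (gaussianPDFReal 0 (Real.toNNReal (σ ^ 2)) |x|) := by
    intro x; simp [gaussianPDF, gaussianPDFReal]
  rw [Measure.map_apply hmeas hA, gaussianReal_apply _ hv, withDensity_apply _ hA,
    ← lintegral_indicator (hmeas hA), ← lintegral_indicator hA]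
  have h1 : ∀ x, ((fun x : ℝ => (ω - |x|) / (ω + |x|)) ⁻¹' A).indicator
      (gaussianPDF 0 (Real.toNNReal (σ ^ 2))) x =
      A.indicator 1 ((ω - |x|) / (ω + |x|)) *
        ENNReal.ofReal (gaussianPDFReal 0 (Real.toNNReal (σ ^ 2)) |x|) := by
    intro x
    rw [← heven]
    by_cases hx : (ω - |x|) / (ω + |x|) ∈ A <;> simp [hx]
  have h2 : ∀ z, A.indicator (fun z => ENNReal.ofReal (giouDensity ω σ z)) z =
      A.indicator 1 z * ENNReal.ofReal (giouDensity ω σ z) := by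
    intro z
    simp only [Set.indicator]
    split_ifs <;> simp
  rw [lintegral_congr h1, lintegral_congr h2, ← setLIntegral_gaussianPDFReal_eq hω hσ]
  exact lintegral_comp_abs fun x => A.indicator 1 ((ω - x) / (ω + x)) *
    ENNReal.ofReal (gaussianPDFReal 0 (Real.toNNReal (σ ^ 2)) x)

/-! ### The Mellin transform of `(1 + t) ^ (-k)` -/

/-- Substituting `t / (1 + t)` in the Beta integral gives the Mellin transform of a negative power
of `1 + t`. -/
theorem hasMellin_one_add_cpow {s v : ℂ} (hs : 0 < s.re) (hv : 0 < v.re) :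
    HasMellin (fun t : ℝ => (1 + t : ℂ) ^ (-(s + v))) s
      (Complex.Gamma s * Complex.Gamma v / Complex.Gamma (s + v)) := by
  set f : ℝ → ℝ := fun t => t / (1 + t) with hf
  have himage : f '' Set.Ioi 0 = Set.Ioo 0 1 := by
    ext x
    simp only [Set.mem_image, Set.mem_Ioo, Set.mem_Ioi, hf]
    constructor
    · rintro ⟨t, ht, rfl⟩
      exact ⟨by positivity, by rw [div_lt_one (by linarith)]; linarith⟩
    · rintro ⟨h0, h1⟩
      have h1' : 1 - x ≠ 0 := by linarith
      refine ⟨x / (1 - x), div_pos h0 (by linarith), ?_⟩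
      rw [show 1 + x / (1 - x) = 1 / (1 - x) by field_simp; ring]
      field_simp
  have hderiv : ∀ t ∈ Set.Ioi (0 : ℝ),
      HasDerivWithinAt f (1 / (1 + t) ^ 2) (Set.Ioi 0) t := by
    intro t ht
    have ht' : 1 + t ≠ 0 := by linarith [Set.mem_Ioi.1 ht]
    refine (((hasDerivAt_id t).div ((hasDerivAt_id t).const_add 1) ht').congr_deriv
      ?_).hasDerivWithinAt
    simp only [id]
    ring
  have hinj : Set.InjOn f (Set.Ioi 0) := by
    intro t ht u hu htu
    have ht' : 1 + t ≠ 0 := by linarith [Set.mem_Ioi.1 ht]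
    have hu' : 1 + u ≠ 0 := by linarith [Set.mem_Ioi.1 hu]
    simp only [hf] at htu
    rw [div_eq_div_iff ht' hu'] at htu
    linarith
  have hcongr : Set.EqOn (fun t : ℝ => |1 / (1 + t) ^ 2| •
        (((f t : ℝ) : ℂ) ^ (s - 1) * (1 - ((f t : ℝ) : ℂ)) ^ (v - 1)))
      (fun t : ℝ => (t : ℂ) ^ (s - 1) • (1 + t : ℂ) ^ (-(s + v))) (Set.Ioi 0) := by
    intro t ht
    rw [Set.mem_Ioi] at ht
    have ht' : 0 < 1 + t := by linarith
    have hne : (1 + t : ℂ) ≠ 0 := by exact_mod_cast ht'.ne'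
    have hinv : (0 : ℝ) ≤ (1 + t)⁻¹ := by positivity
    have harg : (1 + t : ℂ).arg ≠ Real.pi := by
      rw [show (1 + t : ℂ) = ((1 + t : ℝ) : ℂ) by push_cast; rfl,
        Complex.arg_ofReal_of_nonneg ht'.le]
      exact Real.pi_pos.ne
    have h1 : ((f t : ℝ) : ℂ) = (t : ℂ) * (((1 + t)⁻¹ : ℝ) : ℂ) := by
      simp only [hf, div_eq_mul_inv]; push_cast; rfl
    have h2 : 1 - ((f t : ℝ) : ℂ) = (1 + t : ℂ)⁻¹ := by
      simp only [hf]; push_cast; field_simp; ring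
    have h3 : ((|1 / (1 + t) ^ 2| : ℝ) : ℂ) = (1 + t : ℂ) ^ (-2 : ℂ) := by
      rw [abs_of_pos (by positivity), Complex.cpow_neg, one_div]
      push_cast
      rw [← Complex.cpow_ofNat]
    simp only [Complex.real_smul, smul_eq_mul]
    rw [h2, h3, h1, Complex.mul_cpow_ofReal_nonneg ht.le hinv]
    push_cast
    rw [Complex.inv_cpow _ _ harg, Complex.inv_cpow _ _ harg, ← Complex.cpow_neg,
      ← Complex.cpow_neg, show -(s + v) = -2 + (-(s - 1) + -(v - 1)) by ring,
      Complex.cpow_add _ _ hne, Complex.cpow_add _ _ hne]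
    ring
  constructor
  · have h := Complex.betaIntegral_convergent hs hv
    rw [intervalIntegrable_iff_integrableOn_Ioo_of_le zero_le_one, ← himage,
      integrableOn_image_iff_integrableOn_abs_deriv_smul measurableSet_Ioi hderiv hinj] at h
    exact h.congr_fun hcongr measurableSet_Ioi
  · rw [mellin, ← setIntegral_congr_fun measurableSet_Ioi hcongr,
      ← integral_image_eq_integral_abs_deriv_smul measurableSet_Ioi hderiv hinj
        (fun x : ℝ => (x : ℂ) ^ (s - 1) * (1 - (x : ℂ)) ^ (v - 1)), himage,
      ← Complex.betaIntegral_eq_Gamma_mul_div s v hs hv, Complex.betaIntegral,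
      intervalIntegral.integral_of_le zero_le_one, integral_Ioc_eq_integral_Ioo]

theorem hasMellin_inv_one_add_pow {k : ℕ} {s : ℂ} (hs : 0 < s.re) (hk : s.re < k) :
    HasMellin (fun t : ℝ => (((1 + t) ^ k)⁻¹ : ℂ)) s
      (Complex.Gamma s * Complex.Gamma (k - s) / Complex.Gamma k) := by
  have h := hasMellin_one_add_cpow (v := k - s) hs (by simpa using hk)
  simpa only [add_sub_cancel, Complex.cpow_neg, Complex.cpow_natCast] using h

/-! ### Decay of `Γ(s) Γ(k - s)` on vertical lines -/

lemma continuous_Gamma_mul_Gamma {σ : ℝ} {k : ℝ} (hσ : 0 < σ) (hk : σ < k) :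
    Continuous fun t : ℝ => Complex.Gamma (σ + t * Complex.I) *
      Complex.Gamma (k - (σ + t * Complex.I)) := by
  have hG : ∀ s : ℂ, 0 < s.re → ContinuousAt Complex.Gamma s := fun s hs =>
    (Complex.differentiableAt_Gamma s fun m h => by
      rw [h] at hs; simp at hs; linarith [(Nat.cast_nonneg m : (0 : ℝ) ≤ m)]).continuousAt
  rw [continuous_iff_continuousAt]
  intro t
  refine ContinuousAt.mul ?_ ?_
  · refine ContinuousAt.comp (f := fun t : ℝ => (σ + t * Complex.I : ℂ)) (hG _ (by simpa)) ?_
    fun_prop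
  · refine ContinuousAt.comp (f := fun t : ℝ => (k - (σ + t * Complex.I) : ℂ))
      (hG _ (by simpa)) ?_
    fun_prop

/-- Squaring the quadratic lower bound for `cosh` at `π t / 2`; the fourth power of `t` outweighs
the quadratic growth of `Γ(3 - s) / Γ(1 - s)`. -/
lemma sq_one_add_sq_le_cosh_pi_mul (t : ℝ) : (1 + t ^ 2) ^ 2 ≤ Real.cosh (Real.pi * t) := by
  have h1 : 1 + (Real.pi * t / 2) ^ 2 / 2 ≤ Real.cosh (Real.pi * t / 2) := by
    have hs : (Real.pi * t / 4) ^ 2 ≤ Real.sinh (Real.pi * t / 4) ^ 2 := by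
      rw [← sq_abs (Real.sinh _), ← sq_abs (Real.pi * t / 4), Real.abs_sinh]
      gcongr
      exact Real.self_le_sinh_iff.2 (abs_nonneg _)
    have h := Real.cosh_two_mul (Real.pi * t / 4)
    rw [Real.cosh_sq, show 2 * (Real.pi * t / 4) = Real.pi * t / 2 by ring] at h
    rw [h]
    linarith
  have h2 : 1 + t ^ 2 ≤ Real.cosh (Real.pi * t / 2) := by
    refine le_trans ?_ h1
    -- `π² t² / 8 ≥ t²`
    have : 9 ≤ Real.pi ^ 2 := by nlinarith [Real.pi_gt_three]
    nlinarith [sq_nonneg t]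
  have h3 := Real.cosh_two_mul (Real.pi * t / 2)
  rw [show 2 * (Real.pi * t / 2) = Real.pi * t by ring, Real.cosh_sq] at h3
  have h4 := Real.cosh_sq (Real.pi * t / 2)
  have h5 : (1 + t ^ 2) ^ 2 ≤ Real.cosh (Real.pi * t / 2) ^ 2 := by gcongr
  nlinarith [sq_nonneg (Real.sinh (Real.pi * t / 2))]

/-- By the reflection formula, `Γ(s) Γ(1 - s) = π / sin (π s)` decays exponentially on vertical
lines; here only a polynomial rate is recorded. -/
lemma norm_Gamma_mul_Gamma_one_sub_le {σ : ℝ} (h0 : 0 < σ) (h1 : σ < 1) (t : ℝ) :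
    ‖Complex.Gamma (σ + t * Complex.I) * Complex.Gamma (1 - (σ + t * Complex.I))‖ ≤
      Real.pi / Real.sin (Real.pi * σ) * ((1 + t ^ 2) ^ 2)⁻¹ := by
  have hsin : 0 < Real.sin (Real.pi * σ) :=
    Real.sin_pos_of_pos_of_lt_pi (by positivity) (by nlinarith [Real.pi_pos])
  have hcosh := sq_one_add_sq_le_cosh_pi_mul t
  have hre : (Complex.sin (Real.pi * (σ + t * Complex.I))).re =
      Real.sin (Real.pi * σ) * Real.cosh (Real.pi * t) := by
    rw [show (Real.pi * (σ + t * Complex.I) : ℂ) =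
      ((Real.pi * σ : ℝ) : ℂ) + ((Real.pi * t : ℝ) : ℂ) * Complex.I by push_cast; ring,
      Complex.sin_add_mul_I, ← Complex.ofReal_sin, ← Complex.ofReal_cosh, ← Complex.ofReal_cos,
      ← Complex.ofReal_sinh, ← Complex.ofReal_mul, ← Complex.ofReal_mul (Real.cos _),
      Complex.add_re, Complex.re_ofReal_mul, Complex.ofReal_re, Complex.I_re]
    ring
  have hle : Real.sin (Real.pi * σ) * (1 + t ^ 2) ^ 2 ≤
      ‖Complex.sin (Real.pi * (σ + t * Complex.I))‖ := by
    refine le_trans ?_ (Complex.re_le_norm _)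
    rw [hre]
    gcongr
  rw [Complex.Gamma_mul_Gamma_one_sub, norm_div, Complex.norm_real, Real.norm_eq_abs,
    abs_of_pos Real.pi_pos, ← div_eq_mul_inv, div_div]
  gcongr

lemma integrable_Gamma_mul_Gamma_one_sub {σ : ℝ} (h0 : 0 < σ) (h1 : σ < 1) :
    Integrable fun t : ℝ => Complex.Gamma (σ + t * Complex.I) *
      Complex.Gamma (1 - (σ + t * Complex.I)) := by
  have hc := continuous_Gamma_mul_Gamma (k := 1) h0 h1
  rw [Complex.ofReal_one] at hc
  have hsin : 0 < Real.sin (Real.pi * σ) :=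
    Real.sin_pos_of_pos_of_lt_pi (by positivity) (by nlinarith [Real.pi_pos])
  refine (integrable_inv_one_add_sq.const_mul (Real.pi / Real.sin (Real.pi * σ))).mono'
    hc.aestronglyMeasurable (Filter.Eventually.of_forall fun t => ?_)
  refine (norm_Gamma_mul_Gamma_one_sub_le h0 h1 t).trans ?_
  gcongr
  nlinarith [sq_nonneg t]

/-- Two steps of the recurrence reduce `Γ(3 - s)` to `(2 - s) (1 - s) Γ(1 - s)`. -/
lemma integrable_Gamma_mul_Gamma_three_sub {σ : ℝ} (h0 : 0 < σ) (h1 : σ < 1) :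
    Integrable fun t : ℝ => Complex.Gamma (σ + t * Complex.I) *
      Complex.Gamma (3 - (σ + t * Complex.I)) := by
  have hc := continuous_Gamma_mul_Gamma (k := 3) h0 (by linarith)
  rw [Complex.ofReal_ofNat] at hc
  have hsin : 0 < Real.sin (Real.pi * σ) :=
    Real.sin_pos_of_pos_of_lt_pi (by positivity) (by nlinarith [Real.pi_pos])
  refine (integrable_inv_one_add_sq.const_mul (4 * (Real.pi / Real.sin (Real.pi * σ)))).mono'
    hc.aestronglyMeasurable (Filter.Eventually.of_forall fun t => ?_)
  set s : ℂ := σ + t * Complex.I with hs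
  have hre : s.re = σ := by simp [hs]
  have hne1 : 1 - s ≠ 0 := fun h => by
    have := congrArg Complex.re h; simp [hre] at this; linarith
  have hne2 : 2 - s ≠ 0 := fun h => by
    have := congrArg Complex.re h; simp [hre] at this; linarith
  have hrec : Complex.Gamma (3 - s) = (2 - s) * ((1 - s) * Complex.Gamma (1 - s)) := by
    rw [← Complex.Gamma_add_one _ hne1, show 1 - s + 1 = 2 - s by ring,
      ← Complex.Gamma_add_one _ hne2]
    congr 1; ring
  have hnorm : ∀ b : ℝ, 1 ≤ b → ‖(b : ℂ) - s‖ ≤ b + |t| := fun b hb => by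
    rw [show (b : ℂ) - s = ((b - σ : ℝ) : ℂ) - t * Complex.I by rw [hs]; push_cast; ring]
    refine (norm_sub_le _ _).trans ?_
    rw [norm_mul, Complex.norm_I, mul_one, Complex.norm_real, Complex.norm_real, Real.norm_eq_abs,
      Real.norm_eq_abs, abs_of_nonneg (by linarith)]
    linarith
  have hn1 : ‖1 - s‖ ≤ 1 + |t| := by simpa using hnorm 1 le_rfl
  have hn2 : ‖2 - s‖ ≤ 2 + |t| := by simpa using hnorm 2 (by norm_num)
  have hpoly : ‖2 - s‖ * ‖1 - s‖ ≤ 4 * (1 + t ^ 2) := by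
    calc ‖2 - s‖ * ‖1 - s‖ ≤ (2 + |t|) * (1 + |t|) := by gcongr
      _ ≤ 4 * (1 + t ^ 2) := by nlinarith [sq_nonneg (|t| - 1), sq_abs t]
  rw [hrec]
  calc ‖Complex.Gamma s * ((2 - s) * ((1 - s) * Complex.Gamma (1 - s)))‖
      = (‖2 - s‖ * ‖1 - s‖) * ‖Complex.Gamma s * Complex.Gamma (1 - s)‖ := by
        simp only [norm_mul]; ring
    _ ≤ (4 * (1 + t ^ 2)) * (Real.pi / Real.sin (Real.pi * σ) * ((1 + t ^ 2) ^ 2)⁻¹) := by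
        gcongr
        exact norm_Gamma_mul_Gamma_one_sub_le h0 h1 t
    _ = 4 * (Real.pi / Real.sin (Real.pi * σ)) * (1 + t ^ 2)⁻¹ := by field_simp

/-! ### A Mellin-Barnes integral -/

/-- Mellin inversion for `(1 + x) ^ (-k)`. -/
lemma integral_Gamma_mul_Gamma_mul_cpow {k : ℕ} {σ x : ℝ} (h0 : 0 < σ) (hk : σ < k) (hx : 0 < x)
    (hint : Integrable fun t : ℝ => Complex.Gamma (σ + t * Complex.I) *
      Complex.Gamma (k - (σ + t * Complex.I))) :
    ∫ t : ℝ, Complex.Gamma (σ + t * Complex.I) * Complex.Gamma (k - (σ + t * Complex.I)) *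
        (x : ℂ) ^ (-(σ + t * Complex.I)) =
      2 * Real.pi * Complex.Gamma k * ((1 + x : ℂ) ^ k)⁻¹ := by
  set f : ℝ → ℂ := fun t => (((1 + t) ^ k)⁻¹ : ℂ) with hf
  have hk0 : (0 : ℝ) < k := h0.trans hk
  have hΓ : Complex.Gamma k ≠ 0 := Complex.Gamma_ne_zero_of_re_pos (by simpa using hk0)
  have hM : ∀ t : ℝ, HasMellin f (σ + t * Complex.I)
      (Complex.Gamma (σ + t * Complex.I) * Complex.Gamma (k - (σ + t * Complex.I)) /
        Complex.Gamma k) := fun t =>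
    hasMellin_inv_one_add_pow (by simpa using h0) (by simpa using hk)
  have hconv : MellinConvergent f σ := by simpa using (hM 0).1
  have hvert : Complex.VerticalIntegrable (mellin f) σ := by
    refine (hint.div_const (Complex.Gamma k)).congr (Filter.Eventually.of_forall fun t => ?_)
    exact (hM t).2.symm
  have hcont : ContinuousAt f x := by
    refine ContinuousAt.inv₀ (by fun_prop) (pow_ne_zero _ ?_)
    exact_mod_cast (by linarith : 1 + x ≠ 0)
  have hinv := mellinInv_mellin_eq σ f hx hconv hvert hcont
  rw [mellinInv, integral_congr_ae (g := fun t : ℝ => (Complex.Gamma k)⁻¹ *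
      (Complex.Gamma (σ + t * Complex.I) * Complex.Gamma (k - (σ + t * Complex.I)) *
        (x : ℂ) ^ (-(σ + t * Complex.I)))) (Filter.Eventually.of_forall fun t => by
      simp only [(hM t).2, smul_eq_mul]; ring), integral_const_mul, Complex.real_smul] at hinv
  simp only [hf] at hinv
  rw [← hinv]
  have hπ : (Real.pi : ℂ) ≠ 0 := by exact_mod_cast Real.pi_ne_zero
  generalize (∫ t : ℝ, Complex.Gamma (σ + t * Complex.I) *
    Complex.Gamma (k - (σ + t * Complex.I)) * (x : ℂ) ^ (-(σ + t * Complex.I))) = J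
  push_cast
  field_simp

/-- The Mellin transform of a Gaussian at `1 - s`. -/
lemma integral_cpow_mul_exp_neg_sq_div {z : ℝ} (hz : 0 < z) {s : ℂ} (hs : s.re < 1) :
    ∫ v : ℝ in Set.Ioi 0, (v : ℂ) ^ (-s) * Real.exp (-v ^ 2 / z) =
      (√z : ℂ) / 2 * (Complex.Gamma ((1 - s) / 2) * (z : ℂ) ^ (-s / 2)) := by
  have h := mellin_comp_rpow (fun t : ℝ => Complex.exp (-(((1 / z : ℝ) : ℂ) * t))) (1 - s) 2
  have hz' : (z : ℂ) ≠ 0 := by exact_mod_cast hz.ne'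
  have h2 : mellin (fun t : ℝ => Complex.exp (-(((1 / z : ℝ) : ℂ) * t))) ((1 - s) / 2) =
      (z : ℂ) ^ ((1 - s) / 2) * Complex.Gamma ((1 - s) / 2) := by
    have := Complex.integral_cpow_mul_exp_neg_mul_Ioi (a := (1 - s) / 2) (r := 1 / z)
      (by simpa using hs) (by positivity)
    simp only [mellin, smul_eq_mul]
    rw [this]
    congr 2
    push_cast
    field_simp
  have hsqrt : (z : ℂ) ^ (1 / 2 : ℂ) = (√z : ℂ) := by
    rw [Real.sqrt_eq_rpow, Complex.ofReal_cpow hz.le]; push_cast; rfl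
  rw [Complex.ofReal_ofNat, h2, show (1 - s) / 2 = 1 / 2 + -s / 2 by ring,
    Complex.cpow_add _ _ hz', hsqrt, mellin] at h
  rw [show (1 - s) / 2 = 1 / 2 + -s / 2 by ring]
  rw [show (√z : ℂ) / 2 * (Complex.Gamma (1 / 2 + -s / 2) * (z : ℂ) ^ (-s / 2)) =
    |(2 : ℝ)|⁻¹ • ((√z : ℂ) * (z : ℂ) ^ (-s / 2) * Complex.Gamma (1 / 2 + -s / 2)) by
      rw [Complex.real_smul, abs_two]; push_cast; ring, ← h]
  refine setIntegral_congr_fun measurableSet_Ioi fun v _ => ?_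
  simp only [smul_eq_mul, Real.rpow_two]
  rw [show 1 - s - 1 = -s by ring]
  push_cast
  congr 2
  ring

/-- The Mellin-Barnes integral of a Gaussian average of `(1 + v) ^ (-k)`: insert Mellin inversion
for `(1 + v) ^ (-k)` and integrate over `v` first. -/
theorem integral_Gamma_mul_Gamma_mul_Gamma {k : ℕ} {σ z : ℝ} (hz : 0 < z) (h0 : 0 < σ)
    (h1 : σ < 1) (hk : σ < k)
    (hint : Integrable fun t : ℝ => Complex.Gamma (σ + t * Complex.I) *
      Complex.Gamma (k - (σ + t * Complex.I))) :
    (Integrable fun t : ℝ => Complex.Gamma (σ + t * Complex.I) *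
      Complex.Gamma (k - (σ + t * Complex.I)) *
        (Complex.Gamma ((1 - (σ + t * Complex.I)) / 2) * (z : ℂ) ^ (-(σ + t * Complex.I) / 2))) ∧
    ∫ t : ℝ, Complex.Gamma (σ + t * Complex.I) *
      Complex.Gamma (k - (σ + t * Complex.I)) *
        (Complex.Gamma ((1 - (σ + t * Complex.I)) / 2) * (z : ℂ) ^ (-(σ + t * Complex.I) / 2)) =
      4 * Real.pi * Complex.Gamma k / √z *
        ((∫ v in Set.Ioi 0, Real.exp (-v ^ 2 / z) * ((1 + v) ^ k)⁻¹ : ℝ) : ℂ) := by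
  have hsz : (√z : ℂ) ≠ 0 := by exact_mod_cast (Real.sqrt_pos.2 hz).ne'
  set B : ℝ → ℂ := fun t => Complex.Gamma (σ + t * Complex.I) *
      Complex.Gamma (k - (σ + t * Complex.I)) with hB
  set F : ℝ → ℝ → ℂ := fun v t =>
    B t * ((v : ℂ) ^ (-(σ + t * Complex.I)) * Real.exp (-v ^ 2 / z)) with hF
  have hgauss : IntegrableOn (fun v : ℝ => v ^ (-σ) * Real.exp (-v ^ 2 / z)) (Set.Ioi 0) := by
    have := integrableOn_rpow_mul_exp_neg_mul_sq (b := 1 / z) (by positivity)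
      (s := -σ) (by linarith)
    refine this.congr_fun (fun v _ => ?_) measurableSet_Ioi
    simp only
    congr 2
    ring
  have hFint : Integrable (Function.uncurry F)
      ((volume.restrict (Set.Ioi 0)).prod (volume : Measure ℝ)) := by
    have hmeas : AEStronglyMeasurable (Function.uncurry F)
        ((volume.restrict (Set.Ioi 0)).prod (volume : Measure ℝ)) := by
      refine AEStronglyMeasurable.mul hint.aestronglyMeasurable.comp_snd ?_
      refine Measurable.aestronglyMeasurable ?_
      fun_prop
    refine (hgauss.mul_prod hint.norm).mono hmeas ?_
    have hpos : ∀ᵐ p : ℝ × ℝ ∂((volume.restrict (Set.Ioi 0)).prod (volume : Measure ℝ)),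
        0 < p.1 :=
      Measure.quasiMeasurePreserving_fst.ae (ae_restrict_mem measurableSet_Ioi)
    filter_upwards [hpos] with p hp
    refine le_of_eq ?_
    simp only [Function.uncurry, hF, norm_mul, norm_norm]
    rw [Complex.norm_cpow_eq_rpow_re_of_pos hp, Complex.norm_real, Real.norm_eq_abs (p.1 ^ (-σ)),
      abs_of_pos (Real.rpow_pos_of_pos hp _)]
    simp [hB]
    ring
  have hinner : ∀ t : ℝ, ∫ v in Set.Ioi 0, F v t = (√z : ℂ) / 2 * (B t *
      (Complex.Gamma ((1 - (σ + t * Complex.I)) / 2) * (z : ℂ) ^ (-(σ + t * Complex.I) / 2))) := by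
    intro t
    simp only [hF]
    rw [integral_const_mul, integral_cpow_mul_exp_neg_sq_div hz (by simpa using h1)]
    ring
  constructor
  · have h := hFint.integral_prod_right.const_mul ((√z : ℂ) / 2)⁻¹
    refine h.congr (Filter.Eventually.of_forall fun t => ?_)
    simp only [Function.uncurry]
    rw [hinner, ← mul_assoc, inv_mul_cancel₀ (by simpa using hsz), one_mul]
  · have h := integral_integral_swap hFint
    rw [integral_congr_ae (Filter.Eventually.of_forall hinner), integral_const_mul] at h
    have hleft : ∫ v in Set.Ioi 0, ∫ t, F v t = 2 * Real.pi * Complex.Gamma k *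
        ((∫ v in Set.Ioi 0, Real.exp (-v ^ 2 / z) * ((1 + v) ^ k)⁻¹ : ℝ) : ℂ) := by
      rw [← integral_complex_ofReal, ← integral_const_mul]
      refine setIntegral_congr_fun measurableSet_Ioi fun v hv => ?_
      simp only [hF, ← mul_assoc]
      rw [integral_mul_const, integral_Gamma_mul_Gamma_mul_cpow h0 hk hv hint]
      push_cast
      ring
    rw [hleft] at h
    rw [eq_comm, div_mul_eq_mul_div, div_eq_iff hsz]
    linear_combination 2 * h

/-! ### The two Meijer functions -/

/-- Duplication at `-s` and at `1 / 2 + s`. -/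
lemma meijerIntegrand_first_eq (z s : ℂ) :
    meijerIntegrand 2 3 ![0, 1 / 2, 1 / 2] ![1 / 2, 0] z s =
      2 * Real.pi * (Complex.Gamma (-2 * s) * Complex.Gamma ((1 : ℕ) - -2 * s) *
        (Complex.Gamma ((1 - -2 * s) / 2) * z ^ (-(-2 * s) / 2))) := by
  have h1 := Complex.Gamma_mul_Gamma_add_half (-s)
  have h2 := Complex.Gamma_mul_Gamma_add_half (1 / 2 + s)
  have hπ : ((√Real.pi : ℝ) : ℂ) * ((√Real.pi : ℝ) : ℂ) = Real.pi := by
    rw [← Complex.ofReal_mul, Real.mul_self_sqrt Real.pi_pos.le]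
  have h3 : (2 : ℂ) ^ (1 - 2 * -s) * (2 : ℂ) ^ (1 - 2 * (1 / 2 + s)) = 2 := by
    rw [← Complex.cpow_add _ _ two_ne_zero]
    ring_nf
    exact Complex.cpow_one 2
  simp only [meijerIntegrand, Fin.prod_univ_succ, Fin.prod_univ_zero]
  simp
  rw [show (2⁻¹ : ℂ) - s = -s + 1 / 2 by ring, show (1 : ℂ) - 2⁻¹ + s = 1 / 2 + s by ring,
    show (1 : ℂ) + s = 1 / 2 + s + 1 / 2 by ring,
    show (1 + 2 * s) / 2 = 1 / 2 + s by ring, show -(2 * s) = 2 * -s by ring,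
    show 1 + 2 * s = 2 * (1 / 2 + s) by ring]
  calc _ = (Complex.Gamma (-s) * Complex.Gamma (-s + 1 / 2)) *
        (Complex.Gamma (1 / 2 + s) * Complex.Gamma (1 / 2 + s + 1 / 2)) *
        (Complex.Gamma (1 / 2 + s) * z ^ s) := by ring
    _ = ((2 : ℂ) ^ (1 - 2 * -s) * (2 : ℂ) ^ (1 - 2 * (1 / 2 + s))) *
        (((√Real.pi : ℝ) : ℂ) * ((√Real.pi : ℝ) : ℂ)) * (Complex.Gamma (2 * -s) *
          Complex.Gamma (2 * (1 / 2 + s)) * (Complex.Gamma (1 / 2 + s) * z ^ s)) := by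
        rw [h1, h2]; ring
    _ = _ := by rw [h3, hπ]

/-- Duplication at `-s` and at `3 / 2 + s`. -/
lemma meijerIntegrand_second_eq (z s : ℂ) :
    meijerIntegrand 2 3 ![-1, 1 / 2, -1 / 2] ![1 / 2, 0] z s =
      Real.pi / 2 * (Complex.Gamma (-2 * s) * Complex.Gamma ((3 : ℕ) - -2 * s) *
        (Complex.Gamma ((1 - -2 * s) / 2) * z ^ (-(-2 * s) / 2))) := by
  have h1 := Complex.Gamma_mul_Gamma_add_half (-s)
  have h2 := Complex.Gamma_mul_Gamma_add_half (3 / 2 + s)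
  have hπ : ((√Real.pi : ℝ) : ℂ) * ((√Real.pi : ℝ) : ℂ) = Real.pi := by
    rw [← Complex.ofReal_mul, Real.mul_self_sqrt Real.pi_pos.le]
  have h3 : (2 : ℂ) ^ (1 - 2 * -s) * (2 : ℂ) ^ (1 - 2 * (3 / 2 + s)) = 1 / 2 := by
    rw [← Complex.cpow_add _ _ two_ne_zero, one_div, ← Complex.cpow_neg_one]
    congr 1
    ring
  simp only [meijerIntegrand, Fin.prod_univ_succ, Fin.prod_univ_zero]
  simp
  rw [show (2⁻¹ : ℂ) - s = -s + 1 / 2 by ring, show (1 : ℂ) - 2⁻¹ + s = 1 / 2 + s by ring,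
    show (1 : ℂ) + 1 + s = 3 / 2 + s + 1 / 2 by ring,
    show (1 : ℂ) - -1 / 2 + s = 3 / 2 + s by ring,
    show (1 + 2 * s) / 2 = 1 / 2 + s by ring, show -(2 * s) = 2 * -s by ring,
    show 3 + 2 * s = 2 * (3 / 2 + s) by ring]
  calc _ = (Complex.Gamma (-s) * Complex.Gamma (-s + 1 / 2)) *
        (Complex.Gamma (3 / 2 + s) * Complex.Gamma (3 / 2 + s + 1 / 2)) *
        (Complex.Gamma (1 / 2 + s) * z ^ s) := by ring
    _ = ((2 : ℂ) ^ (1 - 2 * -s) * (2 : ℂ) ^ (1 - 2 * (3 / 2 + s))) *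
        (((√Real.pi : ℝ) : ℂ) * ((√Real.pi : ℝ) : ℂ)) * (Complex.Gamma (2 * -s) *
          Complex.Gamma (2 * (3 / 2 + s)) * (Complex.Gamma (1 / 2 + s) * z ^ s)) := by
        rw [h1, h2]; ring
    _ = _ := by rw [h3, hπ]; ring

/-- If duplication brings a Meijer integrand to the form below, then the substitution `s ↦ -2 s`
evaluates the Meijer function. -/
theorem hasMeijerG_of_integrand_eq {m n p q k : ℕ} {a : Fin p → ℂ} {b : Fin q → ℂ}
    {z : ℝ} {K : ℂ}
    (hz : 0 < z) (hk : 1 ≤ k)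
    (hint : ∀ σ : ℝ, 0 < σ → σ < 1 → Integrable fun t : ℝ =>
      Complex.Gamma (σ + t * Complex.I) * Complex.Gamma (k - (σ + t * Complex.I)))
    (heq : ∀ s : ℂ, meijerIntegrand m n a b z s =
      K * (Complex.Gamma (-2 * s) * Complex.Gamma (k - -2 * s) *
        (Complex.Gamma ((1 - -2 * s) / 2) * (z : ℂ) ^ (-(-2 * s) / 2))))
    (hsep : ∀ c : ℝ, MeijerSeparates m n a b c ↔ -(1 / 2) < c ∧ c < 0) :
    HasMeijerG m n a b z (K * Complex.Gamma k / √z *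
      ((∫ v in Set.Ioi 0, Real.exp (-v ^ 2 / z) * ((1 + v) ^ k)⁻¹ : ℝ) : ℂ)) := by
  -- The line `Re s = c` corresponds to `Re (-2 s) = -2 c`, which lies in the strip `(0, 1)`.
  refine ⟨by exact_mod_cast hz.ne', ⟨-(1 / 4), (hsep _).2 (by norm_num)⟩, fun c hc => ?_⟩
  obtain ⟨hc1, hc2⟩ := (hsep c).1 hc
  have hk' : (1 : ℝ) ≤ k := by exact_mod_cast hk
  have h0 : 0 < -2 * c := by linarith
  have h1 : -2 * c < 1 := by linarith
  obtain ⟨hH, hHint⟩ := integral_Gamma_mul_Gamma_mul_Gamma hz h0 h1 (by linarith) (hint _ h0 h1)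
  set H : ℝ → ℂ := fun t : ℝ => Complex.Gamma ((-2 * c : ℝ) + t * Complex.I) *
      Complex.Gamma (k - ((-2 * c : ℝ) + t * Complex.I)) *
        (Complex.Gamma ((1 - ((-2 * c : ℝ) + t * Complex.I)) / 2) *
          (z : ℂ) ^ (-((-2 * c : ℝ) + t * Complex.I) / 2)) with hHdef
  have hline : ∀ t : ℝ, meijerIntegrand m n a b z (c + t * Complex.I) = K * H (-2 * t) := by
    intro t
    rw [heq, hHdef]
    simp only
    rw [show ((-2 * c : ℝ) : ℂ) + ((-2 * t : ℝ) : ℂ) * Complex.I = -2 * (c + t * Complex.I) by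
      push_cast; ring]
  simp only [hline]
  refine ⟨(hH.comp_mul_left' (by norm_num)).const_mul K, ?_⟩
  rw [integral_mul_const, integral_const_mul, Measure.integral_comp_mul_left H, hHint,
    Complex.real_smul, show |(-2 : ℝ)⁻¹| = 1 / 2 by norm_num [abs_of_neg]]
  have hπ : (Real.pi : ℂ) ≠ 0 := by exact_mod_cast Real.pi_ne_zero
  generalize (∫ v in Set.Ioi 0, Real.exp (-v ^ 2 / z) * ((1 + v) ^ k)⁻¹ : ℝ) = M
  have hsz : (√z : ℂ) ≠ 0 := by exact_mod_cast (Real.sqrt_pos.2 hz).ne'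
  have hI := Complex.I_ne_zero
  push_cast
  field_simp
  ring

theorem hasMeijerG_first {z : ℝ} (hz : 0 < z) :
    HasMeijerG 2 3 ![0, 1 / 2, 1 / 2] ![1 / 2, 0] z ((2 * Real.pi / √z *
      ∫ v in Set.Ioi 0, Real.exp (-v ^ 2 / z) * (1 + v)⁻¹ : ℝ) : ℂ) := by
  have h := hasMeijerG_of_integrand_eq (k := 1) hz le_rfl
    (fun σ h0 h1 => by simpa using integrable_Gamma_mul_Gamma_one_sub h0 h1)
    (fun s => meijerIntegrand_first_eq z s) (fun c => by
      simp [MeijerSeparates, Fin.forall_fin_succ]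
      constructor
      · rintro ⟨⟨_, h2⟩, _, h4⟩; constructor <;> linarith
      · rintro ⟨h1, h2⟩; refine ⟨⟨?_, ?_⟩, ?_, ?_⟩ <;> linarith)
  convert h using 1
  simp

theorem hasMeijerG_second {z : ℝ} (hz : 0 < z) :
    HasMeijerG 2 3 ![-1, 1 / 2, -1 / 2] ![1 / 2, 0] z ((Real.pi / √z *
      ∫ v in Set.Ioi 0, Real.exp (-v ^ 2 / z) * ((1 + v) ^ 3)⁻¹ : ℝ) : ℂ) := by
  have h := hasMeijerG_of_integrand_eq (k := 3) hz (by norm_num)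
    (fun σ h0 h1 => by simpa using integrable_Gamma_mul_Gamma_three_sub h0 h1)
    (fun s => meijerIntegrand_second_eq z s) (fun c => by
      simp [MeijerSeparates, Fin.forall_fin_succ]
      constructor
      · rintro ⟨⟨_, h2⟩, _, h4, _⟩; constructor <;> linarith
      · rintro ⟨h1, h2⟩; refine ⟨⟨?_, ?_⟩, ?_, ?_, ?_⟩ <;> linarith)
  convert h using 1
  rw [show Complex.Gamma ((3 : ℕ) : ℂ) = 2 by
    have := Complex.Gamma_nat_eq_factorial 2
    push_cast at this ⊢
    rw [show (3 : ℂ) = 2 + 1 by norm_num, this]; norm_num [Nat.factorial]]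
  push_cast
  ring

/-! ### Moments -/

/-- The mean of a function of `|X| / ω` for `X ∼ 𝒩(0, σ²)`, as an integral over the half-line. -/
lemma integral_gaussianReal_comp_abs_div {ω σ : ℝ} (hω : 0 < ω) (hσ : 0 < σ) (g : ℝ → ℝ) :
    ∫ x, g (|x| / ω) ∂(gaussianReal 0 (Real.toNNReal (σ ^ 2))) =
      2 / (√Real.pi * √(2 * (σ / ω) ^ 2)) *
        ∫ v in Set.Ioi 0, Real.exp (-v ^ 2 / (2 * (σ / ω) ^ 2)) * g v := by
  have hv : Real.toNNReal (σ ^ 2) ≠ 0 := by simpa using hσ.ne'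
  have hscale := integral_comp_mul_left_Ioi
    (fun x => gaussianPDFReal 0 (Real.toNNReal (σ ^ 2)) x * g (x / ω)) 0 hω
  have hpdf : ∀ v, gaussianPDFReal 0 (Real.toNNReal (σ ^ 2)) (ω * v) * g (ω * v / ω) =
      (√(2 * Real.pi) * σ)⁻¹ * (Real.exp (-v ^ 2 / (2 * (σ / ω) ^ 2)) * g v) := by
    intro v
    rw [gaussianPDFReal, Real.coe_toNNReal _ (sq_nonneg σ), Real.sqrt_mul (by positivity) (σ ^ 2),
      Real.sqrt_sq hσ.le, mul_div_cancel_left₀ _ hω.ne',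
      show -(ω * v - 0) ^ 2 / (2 * σ ^ 2) = -v ^ 2 / (2 * (σ / ω) ^ 2) by field_simp; ring]
    ring
  rw [mul_zero, smul_eq_mul, setIntegral_congr_fun measurableSet_Ioi fun v _ => hpdf v,
    integral_const_mul] at hscale
  rw [integral_gaussianReal_eq_integral_smul hv]
  have heven : ∀ x, gaussianPDFReal 0 (Real.toNNReal (σ ^ 2)) x • g (|x| / ω) =
      gaussianPDFReal 0 (Real.toNNReal (σ ^ 2)) |x| * g (|x| / ω) := by
    intro x; simp [gaussianPDFReal]
  rw [integral_congr_ae (Filter.Eventually.of_forall heven),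
    integral_comp_abs (f := fun x => gaussianPDFReal 0 (Real.toNNReal (σ ^ 2)) x * g (x / ω)),
    Real.sqrt_mul (by norm_num) ((σ / ω) ^ 2), Real.sqrt_sq (by positivity)]
  rw [Real.sqrt_mul (by norm_num)] at hscale
  have h : ∀ A B : ℝ, B = ω⁻¹ * A → A = ω * B := fun A B h => by rw [h]; field_simp
  rw [h _ _ hscale]
  field_simp

lemma integrableOn_exp_neg_sq_div_mul {z : ℝ} (hz : 0 < z) {g : ℝ → ℝ} (hg : Measurable g)
    (hg1 : ∀ v, 0 < v → |g v| ≤ 1) :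
    IntegrableOn (fun v => Real.exp (-v ^ 2 / z) * g v) (Set.Ioi 0) := by
  have h : IntegrableOn (fun v => Real.exp (-v ^ 2 / z)) (Set.Ioi 0) := by
    have := (integrable_exp_neg_mul_sq (b := 1 / z) (by positivity)).integrableOn (s := Set.Ioi 0)
    refine this.congr_fun (fun v _ => ?_) measurableSet_Ioi
    simp only
    congr 1; ring
  refine Integrable.mono' h (by fun_prop) ?_
  filter_upwards [ae_restrict_mem measurableSet_Ioi] with v hv
  rw [norm_mul, Real.norm_eq_abs, Real.abs_exp]
  exact mul_le_of_le_one_right (Real.exp_pos _).le (hg1 v hv)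

/-- Integration by parts: `v e^{-v²/z}` is the derivative of `-(z/2) e^{-v²/z}`. -/
lemma integral_exp_neg_sq_div_mul_div_one_add_sq {z : ℝ} (hz : 0 < z) :
    ∫ v in Set.Ioi 0, Real.exp (-v ^ 2 / z) * (v / (1 + v) ^ 2) =
      z / 2 - z * ∫ v in Set.Ioi 0, Real.exp (-v ^ 2 / z) * ((1 + v) ^ 3)⁻¹ := by
  have hA : IntegrableOn (fun v => Real.exp (-v ^ 2 / z) * (v / (1 + v) ^ 2)) (Set.Ioi 0) := by
    refine integrableOn_exp_neg_sq_div_mul hz (by fun_prop) fun v hv => ?_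
    rw [abs_of_pos (by positivity), div_le_one (by positivity)]
    nlinarith
  have hB : IntegrableOn (fun v => Real.exp (-v ^ 2 / z) * ((1 + v) ^ 3)⁻¹) (Set.Ioi 0) := by
    refine integrableOn_exp_neg_sq_div_mul hz (by fun_prop) fun v hv => ?_
    rw [abs_of_pos (by positivity)]
    exact inv_le_one_of_one_le₀ (one_le_pow₀ (by linarith))
  set F : ℝ → ℝ := fun v => -(z / 2) * (Real.exp (-v ^ 2 / z) * ((1 + v) ^ 2)⁻¹) with hF
  have hderiv : ∀ v ∈ Set.Ici (0 : ℝ), HasDerivAt F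
      (Real.exp (-v ^ 2 / z) * (v / (1 + v) ^ 2) +
        z * (Real.exp (-v ^ 2 / z) * ((1 + v) ^ 3)⁻¹)) v := by
    intro v hv
    have hv' : 1 + v ≠ 0 := by linarith [Set.mem_Ici.1 hv]
    have h1 := ((((hasDerivAt_id v).pow 2).neg.div_const z).exp).mul
      ((((hasDerivAt_id v).const_add 1).pow 2).inv (pow_ne_zero 2 hv'))
    refine (h1.const_mul (-(z / 2))).congr_deriv ?_
    simp
    field_simp
    ring
  have hlim : Filter.Tendsto F Filter.atTop (nhds 0) := by
    have h1 : Filter.Tendsto (fun v : ℝ => Real.exp (-v ^ 2 / z)) Filter.atTop (nhds 0) := by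
      have h := Real.tendsto_exp_neg_atTop_nhds_zero.comp
        ((Filter.tendsto_pow_atTop (α := ℝ) two_ne_zero).atTop_div_const hz)
      refine h.congr fun v => ?_
      simp only [Function.comp, neg_div]
    have h2 : Filter.Tendsto (fun v : ℝ => ((1 + v) ^ 2)⁻¹) Filter.atTop (nhds 0) :=
      Filter.Tendsto.inv_tendsto_atTop ((Filter.tendsto_pow_atTop (α := ℝ) two_ne_zero).comp
        (Filter.tendsto_atTop_add_const_left _ 1 Filter.tendsto_id))
    simpa [hF] using (h1.mul h2).const_mul (-(z / 2))
  have h := integral_Ioi_of_hasDerivAt_of_tendsto' hderiv (hA.add (hB.const_mul z)) hlim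
  rw [integral_add hA (hB.const_mul z), integral_const_mul] at h
  have hF0 : F 0 = -(z / 2) := by simp [hF]
  rw [hF0] at h
  linarith

theorem proposition1 {Ω : Type*} [MeasurableSpace Ω] (P : Measure Ω) [IsProbabilityMeasure P]
    (ω σ y a : ℝ) (hω : 0 < ω) (hσ : 0 < σ) (ha : a = σ / ω)
    (X Z : Ω → ℝ) (hX : HasLaw X (gaussianReal 0 (Real.toNNReal (σ ^ 2))) P)
    (hZ : ∀ ξ : Ω, Z ξ = giou (box 0 y ω ω) (box (X ξ) y ω ω)) :
    -- closed form of the criterion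
    (∀ ξ : Ω, Z ξ = (ω - |X ξ|) / (ω + |X ξ|)) ∧
    -- density of `Z`
    HasLaw Z (volume.withDensity (fun z => ENNReal.ofReal (giouDensity ω σ z))) P ∧
    -- the first two moments exist
    Integrable Z P ∧ Integrable (fun ξ => Z ξ ^ 2) P ∧
    -- the two Meijer functions are given by convergent integrals
    HasMeijerG 2 3 ![0, 1 / 2, 1 / 2] ![1 / 2, 0] ((2 * a ^ 2 : ℝ) : ℂ)
      (meijerG 2 3 ![0, 1 / 2, 1 / 2] ![1 / 2, 0] ((2 * a ^ 2 : ℝ) : ℂ)) ∧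
    HasMeijerG 2 3 ![-1, 1 / 2, -1 / 2] ![1 / 2, 0] ((2 * a ^ 2 : ℝ) : ℂ)
      (meijerG 2 3 ![-1, 1 / 2, -1 / 2] ![1 / 2, 0] ((2 * a ^ 2 : ℝ) : ℂ)) ∧
    -- first moment
    ((∫ ξ, Z ξ ∂P : ℝ) : ℂ) =
      ((2 / Real.pi ^ (3 / 2 : ℝ) : ℝ) : ℂ) *
        meijerG 2 3 ![0, 1 / 2, 1 / 2] ![1 / 2, 0] ((2 * a ^ 2 : ℝ) : ℂ) - 1 ∧
    -- second moment
    ((∫ ξ, Z ξ ^ 2 ∂P : ℝ) : ℂ) =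
      1 - ((8 * a / √(2 * Real.pi) : ℝ) : ℂ) +
        ((16 * a ^ 2 / Real.pi ^ (3 / 2 : ℝ) : ℝ) : ℂ) *
          meijerG 2 3 ![-1, 1 / 2, -1 / 2] ![1 / 2, 0] ((2 * a ^ 2 : ℝ) : ℂ) := by
  have ha0 : 0 < a := ha ▸ div_pos hσ hω
  have hz : 0 < 2 * a ^ 2 := by positivity
  have hZX : ∀ ξ, Z ξ = (ω - |X ξ|) / (ω + |X ξ|) := fun ξ => by
    rw [hZ, giou_box_box hω]
  have hlaw : HasLaw Z (volume.withDensity fun z => ENNReal.ofReal (giouDensity ω σ z)) P := by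
    rw [show Z = fun ξ => (ω - |X ξ|) / (ω + |X ξ|) from funext hZX]
    exact (hasLaw_giou_gaussianReal hω hσ).fun_comp hX
  have hbound : ∀ ξ, |Z ξ| ≤ 1 := fun ξ => by
    have h := abs_nonneg (X ξ)
    rw [hZX, abs_div, abs_of_pos (by linarith : 0 < ω + |X ξ|), div_le_one (by linarith), abs_le]
    constructor <;> linarith
  have hint1 : Integrable Z P :=
    Integrable.of_bound hlaw.aemeasurable.aestronglyMeasurable 1
      (Filter.Eventually.of_forall hbound)
  have hint2 : Integrable (fun ξ => Z ξ ^ 2) P :=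
    Integrable.of_bound (hlaw.aemeasurable.pow_const 2).aestronglyMeasurable 1
      (Filter.Eventually.of_forall fun ξ => by
        rw [norm_pow, Real.norm_eq_abs]; exact pow_le_one₀ (abs_nonneg _) (hbound ξ))
  have hG1 := hasMeijerG_first hz
  have hG2 := hasMeijerG_second hz
  have hmean : ∀ g : ℝ → ℝ, Measurable g → ∫ ξ, g (|X ξ| / ω) ∂P = 2 / (√Real.pi * √(2 * a ^ 2)) *
      ∫ v in Set.Ioi 0, Real.exp (-v ^ 2 / (2 * a ^ 2)) * g v := fun g hg => by
    rw [ha, ← integral_gaussianReal_comp_abs_div hω hσ g]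
    exact hX.integral_comp (f := fun x => g (|x| / ω))
      (hg.comp (by fun_prop)).aestronglyMeasurable
  have hboundV : ∀ {g : ℝ → ℝ}, Measurable g → (∀ v, 0 ≤ v → |g v| ≤ 1) →
      Integrable (fun ξ => g (|X ξ| / ω)) P := fun {g} hg hg1 =>
    Integrable.of_bound (hg.comp_aemeasurable (by fun_prop)).aestronglyMeasurable 1
      (Filter.Eventually.of_forall fun ξ => hg1 _ (by positivity))
  have hm1 : ∫ ξ, Z ξ ∂P = 2 * (2 / (√Real.pi * √(2 * a ^ 2)) *
      ∫ v in Set.Ioi 0, Real.exp (-v ^ 2 / (2 * a ^ 2)) * (1 + v)⁻¹) - 1 := by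
    rw [← hmean (fun v => (1 + v)⁻¹) (by fun_prop), ← integral_const_mul]
    have h1 : ∀ ξ, Z ξ = 2 * (1 + |X ξ| / ω)⁻¹ - 1 := fun ξ => by
      have : ω + |X ξ| ≠ 0 := by positivity
      rw [hZX, show 1 + |X ξ| / ω = (ω + |X ξ|) / ω by field_simp]
      field_simp
      ring
    rw [integral_congr_ae (Filter.Eventually.of_forall h1), integral_sub _ (integrable_const _)]
    · simp
    · refine (hboundV (g := fun v => (1 + v)⁻¹) (by fun_prop) fun v hv => ?_).const_mul 2
      rw [abs_of_pos (by positivity)]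
      exact inv_le_one_of_one_le₀ (by linarith)
  have hm2 : ∫ ξ, Z ξ ^ 2 ∂P = 1 - 4 * (2 / (√Real.pi * √(2 * a ^ 2)) *
      (2 * a ^ 2 / 2 - 2 * a ^ 2 *
        ∫ v in Set.Ioi 0, Real.exp (-v ^ 2 / (2 * a ^ 2)) * ((1 + v) ^ 3)⁻¹)) := by
    rw [← integral_exp_neg_sq_div_mul_div_one_add_sq hz,
      ← hmean (fun v => v / (1 + v) ^ 2) (by fun_prop), ← integral_const_mul]
    have h1 : ∀ ξ, Z ξ ^ 2 = 1 - 4 * (|X ξ| / ω / (1 + |X ξ| / ω) ^ 2) := fun ξ => by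
      have : ω + |X ξ| ≠ 0 := by positivity
      rw [hZX, show 1 + |X ξ| / ω = (ω + |X ξ|) / ω by field_simp]
      field_simp
      ring
    rw [integral_congr_ae (Filter.Eventually.of_forall h1), integral_sub (integrable_const _)]
    · simp
    · refine (hboundV (g := fun v => v / (1 + v) ^ 2) (by fun_prop) fun v hv => ?_).const_mul 4
      rw [abs_of_nonneg (by positivity), div_le_one (by positivity)]
      nlinarith
  have hpow : Real.pi ^ (3 / 2 : ℝ) = Real.pi * √Real.pi := by
    rw [show (3 / 2 : ℝ) = 1 + 1 / 2 by norm_num, Real.rpow_add Real.pi_pos, Real.rpow_one,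
      Real.sqrt_eq_rpow]
  have hsqrt : √(2 * a ^ 2) = √2 * a := by rw [Real.sqrt_mul (by norm_num), Real.sqrt_sq ha0.le]
  have hπ := Real.pi_pos
  refine ⟨hZX, hlaw, hint1, hint2, hG1.meijerG_eq ▸ hG1, hG2.meijerG_eq ▸ hG2, ?_, ?_⟩
  · rw [hG1.meijerG_eq, hm1, hpow]
    norm_cast
    congr 1
    field_simp
  · rw [hG2.meijerG_eq, hm2, hpow, hsqrt, Real.sqrt_mul (by norm_num)]
    norm_cast
    generalize (∫ v in Set.Ioi 0, Real.exp (-v ^ 2 / (2 * a ^ 2)) * ((1 + v) ^ 3)⁻¹) = M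
    field_simp
    ring_nf
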